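/- \textbf{Conventions.} A $\mathbf Q$-ideal in a commutative ring $R$ is an equivalence class of symbols $J^q$, with $J\subseteq R$ an ideal and $q\in\mathbf Q_{>0}$, where $J_1^{q_1}\sim J_2^{q_2}$ if for every positive integer $m$ with $mq_1,mq_2\in\mathbf Z$ the ideals $J_1^{mq_1}$ and $J_2^{mq_2}$ have the same integral closure. (For $J\neq 0$ one puts $J^0:=(1)^1$, and the zero $\mathbf Q$-ideal is $(0)^q$ for any $q$.) One writes $J_1^{q_1}\le J_2^{q_2}$ if for every such $m$ the ideal $J_1^{mq_1}$ is contained in the integral closure of $J_2^{mq_2}$; $(J^q)^{r}:=J^{qr}$ for $r\in\mathbf Q_{>0}$; and the pull-back of $J^q$ along a ring homomorphism $R\to S$ is $(JS)^q$. For a field $K$ of characteristic zero, a $\mathbf Q$-ideal $\mathfrak b$ in $\mathbf Q[z_1,\dots,z_n]$ and $u_1,\dots,u_n\in K[[t^{1/N}]]$, $\mathfrak b(u_1,\dots,u_n)$ is the pull-back of $\mathfrak b$ along $z_i\mapsto u_i$, and $\mathfrak bK[z_1,\dots,z_n]$ is its pull-back to $K[z_1,\dots,z_n]$. The order $\mathrm{ord}$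 is taken with respect to $t$, so that the $\mathbf Q$-ideal $(t)^q$ of $K[[t^{1/N}]]$ has order $q$, and $\mathrm{ord}(0)=\infty$. We use $\infty-\infty=\infty$ and $0\cdot\infty=0$. For an algebraically closed field $K$ of characteristic zero and $a=(a_1,\dots,a_d)\in K[[t]]^d$, let $\alpha_1,\dots,\alpha_d$ be the roots, with multiplicity, of $h=y^d+a_1y^{d-1}+\dots+a_d$; they are Puiseux series, lying in $K[[t^{1/N}]]$ for some $N\ge 1$. \textbf{Statement.} (1) Let $d,k$ be positive integers with $k\le d$ and let $c_1,c_2$ be nonnegative rational numbers. There are $\mathbf Q$-ideals $\mathfrak p_+,\mathfrak p_-$ in $\mathbf Q[z_1,\dots,z_d]$, such that for every algebraically closed field $K$ of characteristic zero: (i) if $d\ge 2$, then $\mathfrak p_+K[z_1,\dots,z_d]\le\left(\mathfrak p_-K[z_1,\dots,z_d]\right)^{d/(d-1)}$; (ii) for all $a\in K[[t]]^d$, with $\alpha_1,\dots,\alpha_d$ as above, $$\max_{1\le i\le d}\Big\{c_1\min_{j_1,\dots,j_{k-1}}\mathrm{ord}\prod_{\ell=1}^{k-1}(\alpha_{j_\ell}-\alpha_i)+c_2\min_{j_1,\dots,j_k}\mathrm{ord}\prod_{\ell=1}^{k}(\alpha_{j_\ell}-\alpha_i)\Big\}=\mathrm{ord}\,\mathfrak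 p_+(a)-\mathrm{ord}\,\mathfrak p_-(a),$$ where each minimum is over pairwise distinct elements of $\{1,\dots,d\}$. (2) More generally, let $d\ge1$ and let $\mathfrak b$ be any $\mathbf Q$-ideal in $\mathbf Q[z_1,\dots,z_{d+1}]$. There are $\mathbf Q$-ideals $\mathfrak b_+,\mathfrak b_-$ in $\mathbf Q[z_1,\dots,z_d]$ such that for every algebraically closed field $K$ of characteristic zero: if $d\ge2$, then $\mathfrak b_+K[z_1,\dots,z_d]\le(\mathfrak b_-K[z_1,\dots,z_d])^{d/(d-1)}$; and for all $a\in K[[t]]^d$, with $\alpha_1,\dots,\alpha_d$ as above, $$\max_{1\le i\le d}\mathrm{ord}\,\mathfrak b(a_1,\dots,a_d,\alpha_i)=\mathrm{ord}\,\mathfrak b_+(a)-\mathrm{ord}\,\mathfrak b_-(a).$$ -/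

import Mathlib

open Polynomial
open scoped ENNReal NNReal

/-! ### Integral closure of an ideal -/

/-- `x` is integral of weight `k` over `I`: it satisfies an equation
`x ^ n + c₁ x ^ (n - 1) + ⋯ + cₙ = 0` with `cᵢ ∈ I ^ (k * i)`. -/
def IsWeightIntegral {R : Type*} [CommRing R] (I : Ideal R) (k : ℕ) (x : R) : Prop :=
  ∃ (n : ℕ) (c : ℕ → R), (∀ i, c i ∈ I ^ (k * i)) ∧
    x ^ n + ∑ i ∈ Finset.Icc 1 n, c i * x ^ (n - i) = 0

theorem isIntegral_rees_iff {R : Type*} [CommRing R] (I : Ideal R) (k : ℕ) (x : R) :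
    IsIntegral (reesAlgebra I) (monomial k x) ↔ IsWeightIntegral I k x := by
  constructor
  · rintro ⟨P, hP, hx⟩
    refine ⟨P.natDegree, fun i => (P.coeff (P.natDegree - i) : R[X]).coeff (k * i),
      fun i => (P.coeff (P.natDegree - i)).2 _, ?_⟩
    have h := congrArg (fun f => Polynomial.coeff f (k * P.natDegree)) hx
    simp only [eval₂_eq_sum_range, finsetSum_coeff, coeff_zero, monomial_pow] at h
    have key : ∀ j ∈ Finset.range (P.natDegree + 1),
        ((algebraMap (reesAlgebra I) R[X]) (P.coeff j) * monomial (k * j) (x ^ j)).coeff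
          (k * P.natDegree) = (P.coeff j : R[X]).coeff (k * (P.natDegree - j)) * x ^ j := by
      intro j hj
      have hj' : j ≤ P.natDegree := Nat.lt_succ_iff.mp (Finset.mem_range.mp hj)
      have e : k * P.natDegree = k * (P.natDegree - j) + k * j := by
        rw [← mul_add, Nat.sub_add_cancel hj']
      rw [e, coeff_mul_monomial]
      rfl
    rw [Finset.sum_congr rfl key, Finset.sum_range_succ, add_comm] at h
    have hlead : (P.coeff P.natDegree : R[X]) = 1 := by
      have : P.coeff P.natDegree = 1 := hP
      rw [this]; rfl
    rw [hlead] at h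
    simp only [Nat.sub_self, mul_zero, coeff_one_zero, one_mul] at h
    rw [← h]
    congr 1
    refine Finset.sum_bij' (fun i _ => P.natDegree - i) (fun j _ => P.natDegree - j)
      ?_ ?_ ?_ ?_ ?_
    · intro i hi; simp only [Finset.mem_Icc, Finset.mem_range] at *; omega
    · intro i hi; simp only [Finset.mem_Icc, Finset.mem_range] at *; omega
    · intro i hi; simp only [Finset.mem_Icc] at *; omega
    · intro i hi; simp only [Finset.mem_range] at *; omega
    · intro i hi
      simp only [Finset.mem_Icc] at hi
      have : P.natDegree - (P.natDegree - i) = i := by omega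
      simp only [this]
  · rintro ⟨n, c, hc, hx⟩
    let C' : ℕ → reesAlgebra I := fun i =>
      ⟨monomial (k * i) (c i), reesAlgebra.monomial_mem.mpr (hc i)⟩
    refine ⟨X ^ n + ∑ i ∈ Finset.Icc 1 n, C (C' i) * X ^ (n - i), ?_, ?_⟩
    · rcases subsingleton_or_nontrivial (reesAlgebra I) with hs | hs
      · exact Subsingleton.elim _ _
      apply monic_X_pow_add
      refine lt_of_le_of_lt (degree_sum_le _ _) ?_
      refine (Finset.sup_lt_iff (WithBot.bot_lt_coe n)).mpr ?_
      intro i hi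
      refine lt_of_le_of_lt (degree_C_mul_X_pow_le _ _) ?_
      simp only [Finset.mem_Icc] at hi
      exact WithBot.coe_lt_coe.mpr (by omega : n - i < n)
    · simp only [eval₂_add, eval₂_pow, eval₂_X, eval₂_finsetSum, eval₂_mul, eval₂_C]
      have key : ∀ i ∈ Finset.Icc 1 n, (algebraMap (reesAlgebra I) R[X]) (C' i) *
          (monomial k x) ^ (n - i) = monomial (k * n) (c i * x ^ (n - i)) := by
        intro i hi
        simp only [Finset.mem_Icc] at hi
        have e : k * n = k * i + k * (n - i) := by
          rw [← mul_add]; congr 1; omega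
        rw [monomial_pow, e, ← monomial_mul_monomial]
        rfl
      rw [Finset.sum_congr rfl key, monomial_pow, ← map_sum, ← map_add, hx, map_zero]

theorem isIntegral_rees_one_iff {R : Type*} [CommRing R] (I : Ideal R) (x : R) :
    IsIntegral (reesAlgebra I) (monomial 1 x) ↔
      ∃ (n : ℕ) (c : ℕ → R), (∀ i, c i ∈ I ^ i) ∧
        x ^ n + ∑ i ∈ Finset.Icc 1 n, c i * x ^ (n - i) = 0 := by
  rw [isIntegral_rees_iff]
  simp only [IsWeightIntegral, one_mul]

/-- The integral closure of an ideal `I`: all `x` that satisfy an equation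
`x ^ n + c₁ x ^ (n - 1) + ⋯ + cₙ = 0` with `cᵢ ∈ I ^ i`. -/
def idealClosure {R : Type*} [CommRing R] (I : Ideal R) : Ideal R where
  carrier := {x | ∃ (n : ℕ) (c : ℕ → R), (∀ i, c i ∈ I ^ i) ∧
    x ^ n + ∑ i ∈ Finset.Icc 1 n, c i * x ^ (n - i) = 0}
  add_mem' {x y} hx hy := by
    simp only [Set.mem_ofPred_eq, ← isIntegral_rees_one_iff] at *
    rw [map_add]
    exact hx.add hy
  zero_mem' := by
    simp only [Set.mem_ofPred_eq, ← isIntegral_rees_one_iff, map_zero]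
    exact isIntegral_zero
  smul_mem' r x hx := by
    simp only [Set.mem_ofPred_eq, ← isIntegral_rees_one_iff] at *
    have h : monomial 1 (r • x) = algebraMap (reesAlgebra I) R[X]
        (algebraMap R (reesAlgebra I) r) * monomial 1 x := by
      change _ = (C r : R[X]) * _
      rw [C_mul_monomial, smul_eq_mul]
    rw [h]
    exact isIntegral_algebraMap.mul hx

theorem mem_idealClosure_iff {R : Type*} [CommRing R] {I : Ideal R} {x : R} :
    x ∈ idealClosure I ↔ IsIntegral (reesAlgebra I) (monomial 1 x) :=
  (isIntegral_rees_one_iff I x).symm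

theorem le_idealClosure {R : Type*} [CommRing R] (I : Ideal R) : I ≤ idealClosure I := by
  intro x hx
  rw [mem_idealClosure_iff]
  exact isIntegral_algebraMap (x := (⟨monomial 1 x, reesAlgebra.monomial_mem.mpr
    (by rwa [pow_one])⟩ : reesAlgebra I))

theorem idealClosure_le {R : Type*} [CommRing R] {I J : Ideal R} (h : I ≤ idealClosure J) :
    idealClosure I ≤ idealClosure J := by
  intro x hx
  rw [mem_idealClosure_iff] at *
  have hsub : ∀ f ∈ reesAlgebra I, IsIntegral (reesAlgebra J) f := by
    intro f hf
    rw [← adjoin_monomial_eq_reesAlgebra] at hf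
    have hle : Algebra.adjoin R (Submodule.map (monomial 1 : R →ₗ[R] R[X]) I : Set R[X]) ≤
        (integralClosure (reesAlgebra J) R[X]).restrictScalars R := by
      apply Algebra.adjoin_le
      rintro _ ⟨r, hr, rfl⟩
      exact mem_idealClosure_iff.mp (h hr)
    exact hle hf
  let A := integralClosure (reesAlgebra J) R[X]
  have hA : IsIntegral A (monomial 1 x : R[X]) := by
    obtain ⟨P, hP, hx⟩ := hx
    let g : reesAlgebra I →+* A :=
      { toFun := fun f => ⟨f.1, hsub f.1 f.2⟩
        map_one' := rfl
        map_mul' := fun _ _ => rfl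
        map_zero' := rfl
        map_add' := fun _ _ => rfl }
    refine ⟨P.map g, hP.map g, ?_⟩
    rw [eval₂_map]
    exact hx
  exact isIntegral_trans (R := reesAlgebra J) (A := A) _ hA

theorem mem_idealClosure_of_pow {R : Type*} [CommRing R] {I : Ideal R} {x : R} {k : ℕ}
    (hk : 0 < k) (h : x ^ k ∈ idealClosure (I ^ k)) : x ∈ idealClosure I := by
  rw [mem_idealClosure_iff]
  obtain ⟨n, c, hc, hx⟩ := h
  have h' : IsWeightIntegral I k (x ^ k) := ⟨n, c, fun i => by rw [pow_mul]; exact hc i, hx⟩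
  rw [← isIntegral_rees_iff] at h'
  apply IsIntegral.of_pow hk
  rwa [monomial_pow, one_mul]

theorem le_idealClosure_of_pow {R : Type*} [CommRing R] {I J : Ideal R} {k : ℕ}
    (hk : 0 < k) (h : I ^ k ≤ idealClosure (J ^ k)) : I ≤ idealClosure J :=
  fun _ hx => mem_idealClosure_of_pow hk (h (Ideal.pow_mem_pow hx k))

theorem map_idealClosure_le {R S : Type*} [CommRing R] [CommRing S] (φ : R →+* S)
    (I : Ideal R) : (idealClosure I).map φ ≤ idealClosure (I.map φ) := by
  rw [Ideal.map_le_iff_le_comap]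
  rintro x ⟨n, c, hc, hx⟩
  refine ⟨n, fun i => φ (c i), fun i => ?_, ?_⟩
  · rw [← Ideal.map_pow]
    exact Ideal.mem_map_of_mem φ (hc i)
  · simpa using congrArg φ hx

/-! ### `ℚ`-ideals -/

/-- Symbols `J ^ q`, with `J` an ideal and `q` a positive rational number. (A symbol `J ^ 0` with
`J` nonzero is equivalent to `(1) ^ 1`, and `(0) ^ 0` is by convention the same as `(0) ^ 1`,
so that restricting to positive exponents does not change the set of equivalence classes.) -/
structure QSymbol (R : Type*) [CommRing R] where
  ideal : Ideal R
  exp : ℚ≥0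
  exp_pos : 0 < exp

namespace QSymbol

variable {R S : Type*} [CommRing R] [CommRing S]

/-- `J₁ ^ q₁ ≤ J₂ ^ q₂` if for every positive integer `m` with `m q₁` and `m q₂` integers,
`J₁ ^ (m q₁)` is contained in the integral closure of `J₂ ^ (m q₂)`. -/
protected def LE (s t : QSymbol R) : Prop :=
  ∀ m n₁ n₂ : ℕ, 0 < m → (m : ℚ≥0) * s.exp = n₁ → (m : ℚ≥0) * t.exp = n₂ →
    s.ideal ^ n₁ ≤ idealClosure (t.ideal ^ n₂)

/-- `J₁ ^ q₁` and `J₂ ^ q₂` are equivalent if for every positive integer `m` with `m q₁` and `m q₂`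
integers, `J₁ ^ (m q₁)` and `J₂ ^ (m q₂)` have the same integral closure. -/
protected def Equiv (s t : QSymbol R) : Prop :=
  ∀ m n₁ n₂ : ℕ, 0 < m → (m : ℚ≥0) * s.exp = n₁ → (m : ℚ≥0) * t.exp = n₂ →
    idealClosure (s.ideal ^ n₁) = idealClosure (t.ideal ^ n₂)

theorem equiv_iff {s t : QSymbol R} : s.Equiv t ↔ s.LE t ∧ t.LE s := by
  constructor
  · intro h
    refine ⟨fun m n₁ n₂ hm h₁ h₂ => ?_, fun m n₁ n₂ hm h₁ h₂ => ?_⟩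
    · exact (le_idealClosure _).trans (h m n₁ n₂ hm h₁ h₂).le
    · exact (le_idealClosure _).trans (h m n₂ n₁ hm h₂ h₁).ge
  · rintro ⟨h, h'⟩ m n₁ n₂ hm h₁ h₂
    exact le_antisymm (idealClosure_le (h m n₁ n₂ hm h₁ h₂))
      (idealClosure_le (h' m n₂ n₁ hm h₂ h₁))

protected theorem LE.refl (s : QSymbol R) : s.LE s := by
  intro m n₁ n₂ _ h₁ h₂
  have : n₁ = n₂ := by exact_mod_cast h₁.symm.trans h₂
  rw [this]
  exact le_idealClosure _

protected theorem LE.trans {s t u : QSymbol R} (h : s.LE t) (h' : t.LE u) : s.LE u := by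
  intro m n₁ n₃ hm h₁ h₃
  have hk : 0 < t.exp.den := t.exp.den_pos
  have e₂ : ((m * t.exp.den : ℕ) : ℚ≥0) * t.exp = (m * t.exp.num : ℕ) := by
    push_cast
    rw [mul_assoc, NNRat.den_mul_eq_num]
  have e₁ : ((m * t.exp.den : ℕ) : ℚ≥0) * s.exp = (n₁ * t.exp.den : ℕ) := by
    push_cast
    rw [← h₁]; ring
  have e₃ : ((m * t.exp.den : ℕ) : ℚ≥0) * u.exp = (n₃ * t.exp.den : ℕ) := by
    push_cast
    rw [← h₃]; ring
  have hm' : 0 < m * t.exp.den := Nat.mul_pos hm hk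
  refine le_idealClosure_of_pow hk ?_
  rw [← pow_mul, ← pow_mul]
  exact (h _ _ _ hm' e₁ e₂).trans (idealClosure_le (h' _ _ _ hm' e₂ e₃))

/-- The equivalence relation on symbols. -/
instance setoid (R : Type*) [CommRing R] : Setoid (QSymbol R) where
  r := QSymbol.Equiv
  iseqv :=
    { refl := fun s => equiv_iff.mpr ⟨LE.refl s, LE.refl s⟩
      symm := fun h => equiv_iff.mpr (equiv_iff.mp h).symm
      trans := fun h h' => by
        rw [equiv_iff] at *
        exact ⟨h.1.trans h'.1, h'.2.trans h.2⟩ }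

/-- Pull-back of a symbol along a ring homomorphism: `J ^ q` goes to `(J S) ^ q`. -/
def map (φ : R →+* S) (s : QSymbol R) : QSymbol S :=
  ⟨s.ideal.map φ, s.exp, s.exp_pos⟩

theorem LE.map (φ : R →+* S) {s t : QSymbol R} (h : s.LE t) : (s.map φ).LE (t.map φ) := by
  intro m n₁ n₂ hm h₁ h₂
  change (s.ideal.map φ) ^ n₁ ≤ idealClosure ((t.ideal.map φ) ^ n₂)
  rw [← Ideal.map_pow, ← Ideal.map_pow]
  exact (Ideal.map_mono (h m n₁ n₂ hm h₁ h₂)).trans (map_idealClosure_le φ _)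

/-- Rational powers of a symbol: `(J ^ q) ^ r = J ^ (q r)`. -/
def pow (r : ℚ≥0) (hr : 0 < r) (s : QSymbol R) : QSymbol R :=
  ⟨s.ideal, s.exp * r, mul_pos s.exp_pos hr⟩

theorem LE.pow (r : ℚ≥0) (hr : 0 < r) {s t : QSymbol R} (h : s.LE t) :
    (s.pow r hr).LE (t.pow r hr) := by
  intro m n₁ n₂ hm h₁ h₂
  simp only [QSymbol.pow] at *
  have hd : r * r.den = r.num := NNRat.mul_den_eq_num r
  have hnum : 0 < r.num := by
    have := NNRat.num_ne_zero.mpr hr.ne'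
    omega
  refine le_idealClosure_of_pow r.den_pos ?_
  rw [← pow_mul, ← pow_mul]
  refine h (m * r.num) _ _ (Nat.mul_pos hm hnum) ?_ ?_
  · push_cast
    rw [← h₁, ← hd]; ring
  · push_cast
    rw [← h₂, ← hd]; ring

end QSymbol

/-- `ℚ`-ideals in a ring: equivalence classes of symbols `J ^ q`. -/
def QIdeal (R : Type*) [CommRing R] : Type _ := Quotient (QSymbol.setoid R)

namespace QIdeal

variable {R S : Type*} [CommRing R] [CommRing S]

/-- The order relation on `ℚ`-ideals. -/
instance : LE (QIdeal R) where
  le := Quotient.lift₂ QSymbol.LE (by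
    intro s t s' t' h h'
    obtain ⟨h₁, h₂⟩ := QSymbol.equiv_iff.mp h
    obtain ⟨h₁', h₂'⟩ := QSymbol.equiv_iff.mp h'
    exact propext ⟨fun k => (h₂.trans k).trans h₁', fun k => (h₁.trans k).trans h₂'⟩)

/-- The pull-back of a `ℚ`-ideal along a ring homomorphism. -/
def map (φ : R →+* S) : QIdeal R → QIdeal S :=
  Quotient.map (QSymbol.map φ) (by
    intro s t h
    obtain ⟨h₁, h₂⟩ := QSymbol.equiv_iff.mp h
    exact QSymbol.equiv_iff.mpr ⟨h₁.map φ, h₂.map φ⟩)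

/-- Positive rational powers of a `ℚ`-ideal. -/
def pow (𝔞 : QIdeal R) (r : ℚ≥0) (hr : 0 < r) : QIdeal R :=
  Quotient.map (QSymbol.pow r hr) (by
    intro s t h
    obtain ⟨h₁, h₂⟩ := QSymbol.equiv_iff.mp h
    exact QSymbol.equiv_iff.mpr ⟨h₁.pow r hr, h₂.pow r hr⟩) 𝔞

end QIdeal

/-! ### Orders in `K⟦t^{1/N}⟧`

An element of `K⟦t^{1/N}⟧` is written as `f(t^{1/N})` with `f : PowerSeries K`, so that
`K⟦t^{1/N}⟧` is the ring `PowerSeries K` in the variable `t^{1/N}`, and `K⟦t⟧` is embedded in it by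
`PowerSeries.expand N`, which replaces the variable by its `N`-th power. -/

noncomputable section

variable {K : Type*} [Field K]

/-- The order in `t` of the element `f(t^{1/N})` of `K⟦t^{1/N}⟧`, with `ord 0 = ∞`. -/
def ordT (N : ℕ) (f : PowerSeries K) : ℝ≥0∞ := (f.order : ℝ≥0∞) / N

theorem nsmul_le_order_of_mem_pow {I : Ideal (PowerSeries K)} {e : ℕ∞}
    (he : ∀ y ∈ I, e ≤ y.order) (n : ℕ) : ∀ y ∈ I ^ n, n • e ≤ y.order := by
  induction n with
  | zero => simp
  | succ n ih =>
    intro y hy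
    rw [pow_succ] at hy
    refine Submodule.mul_induction_on hy ?_ ?_
    · intro a ha b hb
      rw [succ_nsmul]
      exact (add_le_add (ih a ha) (he b hb)).trans (PowerSeries.le_order_mul a b)
    · intro a b ha hb
      exact (le_min ha hb).trans (PowerSeries.min_order_le_order_add a b)

theorem order_sum_ge {ι : Type*} (s : Finset ι) (f : ι → PowerSeries K) (e : ℕ∞)
    (h : ∀ i ∈ s, e ≤ (f i).order) : e ≤ (∑ i ∈ s, f i).order := by
  classical
  induction s using Finset.induction_on with
  | empty => simp
  | insert a s ha ih =>
    rw [Finset.sum_insert ha]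
    refine le_trans (le_min (h _ (Finset.mem_insert_self _ _))
      (ih fun i hi => h i (Finset.mem_insert_of_mem hi))) (PowerSeries.min_order_le_order_add _ _)

theorem le_order_of_mem_idealClosure {I : Ideal (PowerSeries K)} {e : ℕ∞}
    (he : ∀ y ∈ I, e ≤ y.order) {x : PowerSeries K} (hx : x ∈ idealClosure I) :
    e ≤ x.order := by
  by_contra hlt
  rw [not_le] at hlt
  obtain ⟨n, c, hc, hx⟩ := hx
  obtain ⟨a, ha⟩ := ENat.ne_top_iff_exists.mp hlt.ne_top
  have hxn : (x ^ n).order = (n * a : ℕ) := by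
    rw [PowerSeries.order_pow, ← ha]; simp
  have h1 : ((n * a + 1 : ℕ) : ℕ∞) ≤ (x ^ n).order := by
    rw [eq_neg_of_add_eq_zero_left hx, PowerSeries.order_neg]
    apply order_sum_ge
    intro i hi
    simp only [Finset.mem_Icc] at hi
    have h2 : ((a + 1 : ℕ) : ℕ∞) ≤ e := by
      rw [← ha] at hlt
      push_cast
      exact Order.add_one_le_of_lt hlt
    have h3 := nsmul_le_order_of_mem_pow (fun y hy => h2.trans (he y hy)) i (c i) (hc i)
    rw [PowerSeries.order_mul, PowerSeries.order_pow, ← ha]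
    refine le_trans ?_ (add_le_add_left h3 _)
    simp only [nsmul_eq_mul]
    norm_cast
    obtain ⟨j, rfl⟩ := Nat.exists_eq_add_of_le hi.2
    have : i + j - i = j := by omega
    rw [this]
    nlinarith
  rw [hxn] at h1
  have : n * a + 1 ≤ n * a := by exact_mod_cast h1
  omega

/-- The order of the ideal `J` in the variable of the power series ring. -/
def idealOrd (J : Ideal (PowerSeries K)) : ℕ∞ := ⨅ f ∈ J, PowerSeries.order f

theorem exists_order_eq_idealOrd (J : Ideal (PowerSeries K)) :
    ∃ f ∈ J, PowerSeries.order f = idealOrd J := by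
  have h : sInf ((fun f : PowerSeries K => f.order) '' (J : Set (PowerSeries K))) ∈
      ((fun f : PowerSeries K => f.order) '' (J : Set (PowerSeries K))) :=
    csInf_mem (Set.Nonempty.image _ ⟨0, J.zero_mem⟩)
  obtain ⟨f, hf, h⟩ := h
  refine ⟨f, hf, ?_⟩
  refine Eq.trans h ?_
  rw [sInf_image]
  rfl

/-- The order in `t` of the symbol `J ^ q` in `K⟦t^{1/N}⟧`. -/
def QSymbol.ord (N : ℕ) (s : QSymbol (PowerSeries K)) : ℝ≥0∞ :=
  ((s.exp : ℝ≥0) : ℝ≥0∞) * (((idealOrd s.ideal : ℕ∞) : ℝ≥0∞) / N)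

theorem QSymbol.LE.ord_le (N : ℕ) {s t : QSymbol (PowerSeries K)} (h : s.LE t) :
    t.ord N ≤ s.ord N := by
  obtain ⟨f, hf, hfo⟩ := exists_order_eq_idealOrd s.ideal
  set m := s.exp.den * t.exp.den with hm
  have hm0 : 0 < m := Nat.mul_pos s.exp.den_pos t.exp.den_pos
  have e₁ : (m : ℚ≥0) * s.exp = (s.exp.num * t.exp.den : ℕ) := by
    rw [hm]; push_cast; rw [mul_right_comm, NNRat.den_mul_eq_num]
  have e₂ : (m : ℚ≥0) * t.exp = (s.exp.den * t.exp.num : ℕ) := by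
    rw [hm]; push_cast; rw [mul_assoc, NNRat.den_mul_eq_num]
  have h1 := h m _ _ hm0 e₁ e₂ (Ideal.pow_mem_pow hf _)
  have h2 : ∀ y ∈ t.ideal, idealOrd t.ideal ≤ y.order := fun y hy => iInf₂_le y hy
  have h3 := le_order_of_mem_idealClosure (nsmul_le_order_of_mem_pow h2 _) h1
  rw [PowerSeries.order_pow, hfo] at h3
  generalize s.exp.num * t.exp.den = n₁ at *
  generalize s.exp.den * t.exp.num = n₂ at *
  have h4 : (n₂ : ℝ≥0∞) * (idealOrd t.ideal : ℝ≥0∞) ≤ n₁ * (idealOrd s.ideal : ℝ≥0∞) := by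
    have := ENat.toENNReal_le.mpr h3
    simpa [nsmul_eq_mul] using this
  have c₁ : (n₁ : ℝ≥0∞) = m * ((s.exp : ℝ≥0) : ℝ≥0∞) := by
    have : (n₁ : ℝ≥0) = m * (s.exp : ℝ≥0) := by exact_mod_cast e₁.symm
    exact_mod_cast congrArg (fun x : ℝ≥0 => (x : ℝ≥0∞)) this
  have c₂ : (n₂ : ℝ≥0∞) = m * ((t.exp : ℝ≥0) : ℝ≥0∞) := by
    have : (n₂ : ℝ≥0) = m * (t.exp : ℝ≥0) := by exact_mod_cast e₂.symm
    exact_mod_cast congrArg (fun x : ℝ≥0 => (x : ℝ≥0∞)) this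
  rw [c₁, c₂, mul_assoc, mul_assoc, ENNReal.mul_le_mul_iff_right (by exact_mod_cast hm0.ne')
    (ENNReal.natCast_ne_top m)] at h4
  simp only [QSymbol.ord, ← mul_div_assoc]
  exact ENNReal.div_le_div_right h4 _

/-- The order in `t` of a `ℚ`-ideal in `K⟦t^{1/N}⟧`, a nonnegative rational number or `∞`; the
order of `(t) ^ q` is `q`, and the order of the zero ideal is `∞`. -/
def QIdeal.ord (N : ℕ) : QIdeal (PowerSeries K) → ℝ≥0∞ :=
  Quotient.lift (QSymbol.ord N) (by
    intro s t h
    obtain ⟨h₁, h₂⟩ := QSymbol.equiv_iff.mp h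
    exact le_antisymm (h₂.ord_le N) (h₁.ord_le N))

/-- For a `ℚ`-ideal `𝔟` in `ℚ[z₁, …, zₙ]` and `u₁, …, uₙ` in a power series ring over `K`, the
`ℚ`-ideal `𝔟(u₁, …, uₙ)`: the pull-back of `𝔟` by `zᵢ ↦ uᵢ`. -/
def QIdeal.evalAt [CharZero K] {n : ℕ} (𝔟 : QIdeal (MvPolynomial (Fin n) ℚ))
    (u : Fin n → PowerSeries K) : QIdeal (PowerSeries K) :=
  𝔟.map (MvPolynomial.aeval u : MvPolynomial (Fin n) ℚ →ₐ[ℚ] PowerSeries K).toRingHom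

/-- The `ℚ`-ideal `𝔟 K[z₁, …, zₙ]` generated by a `ℚ`-ideal `𝔟` in `ℚ[z₁, …, zₙ]`. -/
def QIdeal.baseChange (K : Type*) [Field K] [CharZero K] {n : ℕ}
    (𝔟 : QIdeal (MvPolynomial (Fin n) ℚ)) : QIdeal (MvPolynomial (Fin n) K) :=
  𝔟.map (MvPolynomial.map (algebraMap ℚ K))

/-- Difference of orders, with the convention `∞ - ∞ = ∞`. -/
def ordSub (p m : ℝ≥0∞) : EReal := if p = ⊤ then ⊤ else (p : EReal) - (m : EReal)

/-- The polynomial `y ^ d + a₁ y ^ (d - 1) + ⋯ + a_d`. -/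
def monicPoly {A : Type*} [CommRing A] {d : ℕ} (a : Fin d → A) : A[X] :=
  X ^ d + ∑ i : Fin d, C (a i) * X ^ (d - 1 - (i : ℕ))

/-- The elements `α₁, …, α_d` of `K⟦t^{1/N}⟧` are the roots, listed with multiplicity, of
`y ^ d + a₁ y ^ (d - 1) + ⋯ + a_d`, where `a₁, …, a_d` are in `K⟦t⟧`. -/
def AreRoots (N : ℕ) (hN : N ≠ 0) {d : ℕ} (a α : Fin d → PowerSeries K) : Prop :=
  monicPoly (fun i => PowerSeries.expand N hN (a i)) = ∏ i : Fin d, (X - C (α i))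

/-- The minimum of `ord ∏ (α_{j_ℓ} - w)`, `1 ≤ ℓ ≤ k`, over distinct `j₁, …, j_k`. -/
def minOrdProd (N : ℕ) {d : ℕ} (k : ℕ) (α : Fin d → PowerSeries K) (w : PowerSeries K) : ℝ≥0∞ :=
  ⨅ j : Fin k ↪ Fin d, ordT N (∏ l : Fin k, (α (j l) - w))

end

/-- The exponent `d / (d - 1)` is positive for `d ≥ 2`. -/
theorem exponent_pos {d : ℕ} (hd : 2 ≤ d) : (0 : ℚ≥0) < (d : ℚ≥0) / ((d - 1 : ℕ) : ℚ≥0) :=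
  div_pos (by exact_mod_cast (by omega : 0 < d)) (by exact_mod_cast (by omega : 0 < d - 1))

/-!
For a family of ideals `Jᵢ` of `K⟦t^{1/N}⟧` the largest of the orders is
`ord ∏ᵢ Jᵢ - ord ∑ᵢ ∏_{j ≠ i} Jⱼ`, since the second order omits exactly the largest summand of the
first. When `Jᵢ` is the value at the roots `α` of an ideal in `ℚ[x₁, …, x_d]` and these ideals are
permuted with the variables, the product and the sum of partial products come from symmetric
ideals `I`. For such an `I` the value of `I ^ d!` at `α` is the value at the coefficients `a` of an
ideal in `ℚ[z₁, …, z_d]`: if `F` is a polynomial with content ideal `I`, then the product of the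
conjugates of `F` has symmetric coefficients, and its content ideal at `α` is `I(α) ^ d!` by Gauss's
lemma. The comparison of the two `ℚ`-ideals comes from
`(∏ᵢ Jᵢ) ^ (d - 1) ≤ (∑ᵢ ∏_{j ≠ i} Jⱼ) ^ d`.
-/

section IdealOrder

variable {K : Type*} [Field K]

theorem le_idealOrd_iff {J : Ideal (PowerSeries K)} {e : ℕ∞} :
    e ≤ idealOrd J ↔ ∀ f ∈ J, e ≤ f.order := by
  simp only [idealOrd, le_iInf_iff]

theorem idealOrd_span (s : Set (PowerSeries K)) :
    idealOrd (Ideal.span s) = ⨅ f ∈ s, f.order := by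
  refine le_antisymm (biInf_mono fun f hf => Ideal.subset_span hf) ?_
  refine le_idealOrd_iff.mpr fun f hf => ?_
  induction hf using Submodule.span_induction with
  | mem f hf => exact iInf₂_le f hf
  | zero => simp
  | add f g _ _ hf hg => exact (le_min hf hg).trans (PowerSeries.min_order_le_order_add f g)
  | smul r f _ hf =>
    rw [smul_eq_mul, PowerSeries.order_mul]
    exact hf.trans le_add_self

theorem idealOrd_top : idealOrd (⊤ : Ideal (PowerSeries K)) = 0 := by
  rw [← Ideal.span_singleton_one, idealOrd_span]
  simp

theorem idealOrd_iSup {ι : Sort*} (I : ι → Ideal (PowerSeries K)) :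
    idealOrd (⨆ i, I i) = ⨅ i, idealOrd (I i) := by
  rw [← Submodule.span_eq (⨆ i, I i), Submodule.iSup_eq_span, Submodule.span_span]
  refine (idealOrd_span _).trans ?_
  rw [iInf_iUnion]
  rfl

theorem idealOrd_mul (I J : Ideal (PowerSeries K)) :
    idealOrd (I * J) = idealOrd I + idealOrd J := by
  apply le_antisymm
  · obtain ⟨f, hf, hf_ord⟩ := exists_order_eq_idealOrd I
    obtain ⟨g, hg, hg_ord⟩ := exists_order_eq_idealOrd J
    rw [← hf_ord, ← hg_ord, ← PowerSeries.order_mul]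
    exact iInf₂_le _ (Ideal.mul_mem_mul hf hg)
  · refine le_idealOrd_iff.mpr fun y hy => ?_
    refine Submodule.mul_induction_on hy (fun f hf g hg => ?_) fun f g hf hg =>
      (le_min hf hg).trans (PowerSeries.min_order_le_order_add f g)
    rw [PowerSeries.order_mul]
    exact add_le_add (iInf₂_le f hf) (iInf₂_le g hg)

theorem idealOrd_prod {ι : Type*} (s : Finset ι) (I : ι → Ideal (PowerSeries K)) :
    idealOrd (∏ i ∈ s, I i) = ∑ i ∈ s, idealOrd (I i) := by
  classical
  induction s using Finset.induction_on with
  | empty => simp [Ideal.one_eq_top, idealOrd_top]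
  | insert i s hi ih => rw [Finset.prod_insert hi, Finset.sum_insert hi, idealOrd_mul, ih]

theorem idealOrd_pow (I : Ideal (PowerSeries K)) (n : ℕ) : idealOrd (I ^ n) = n * idealOrd I := by
  simpa using idealOrd_prod (Finset.range n) fun _ => I

theorem idealOrd_map_expand (I : Ideal (PowerSeries K)) {N : ℕ} (hN : N ≠ 0) :
    idealOrd (I.map (PowerSeries.expand N hN)) = N * idealOrd I := by
  have hN' : (N : ℕ∞) ≠ 0 := by exact_mod_cast hN
  rw [Ideal.map, idealOrd_span, iInf_image, idealOrd]
  simp only [SetLike.mem_coe, PowerSeries.order_expand, nsmul_eq_mul, ENat.mul_iInf_of_ne hN']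

end IdealOrder

section ContentIdeal

theorem contentIdeal_mul_of_isPrincipalIdealRing {A : Type*} [CommRing A] [IsDomain A]
    [IsPrincipalIdealRing A] (p q : A[X]) :
    (p * q).contentIdeal = p.contentIdeal * q.contentIdeal := by
  obtain ⟨normalization⟩ : Nonempty (StrongNormalizationMonoid A) := inferInstance
  let := UniqueFactorizationMonoid.toStrongNormalizedGCDMonoid A
  have eq_span_content (r : A[X]) : r.contentIdeal = Ideal.span {r.content} :=
    Submodule.IsPrincipal.contentIdeal_eq_span_content_of_isPrincipal
      (IsPrincipalIdealRing.principal _)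
  rw [eq_span_content, eq_span_content p, eq_span_content q, content_mul,
    Ideal.span_singleton_mul_span_singleton]

theorem contentIdeal_prod_of_isPrincipalIdealRing {ι A : Type*} [CommRing A] [IsDomain A]
    [IsPrincipalIdealRing A] (s : Finset ι) (p : ι → A[X]) :
    (∏ i ∈ s, p i).contentIdeal = ∏ i ∈ s, (p i).contentIdeal := by
  classical
  induction s using Finset.induction_on with
  | empty => simp [Ideal.one_eq_top]
  | insert i s hi ih =>
    rw [Finset.prod_insert hi, Finset.prod_insert hi, contentIdeal_mul_of_isPrincipalIdealRing, ih]

theorem contentIdeal_ofFn {R : Type*} [Semiring R] [DecidableEq R] {n : ℕ} (v : Fin n → R) :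
    (ofFn n v).contentIdeal = Ideal.span (Set.range v) := by
  refine le_antisymm (Ideal.span_le.mpr fun r hr => ?_) (Ideal.span_le.mpr ?_)
  · obtain ⟨i, hi, rfl⟩ := mem_coeffs_iff.mp hr
    have hin : i < n := lt_of_not_ge fun h => mem_support_iff.mp hi (ofFn_coeff_eq_zero_of_ge v h)
    exact Ideal.subset_span ⟨⟨i, hin⟩, (ofFn_coeff_eq_val_of_lt v hin).symm⟩
  · rintro _ ⟨i, rfl⟩
    simpa using (ofFn n v).coeff_mem_contentIdeal i

theorem exists_contentIdeal_eq {R : Type*} [Semiring R] {I : Ideal R} (hI : I.FG) :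
    ∃ F : R[X], F.contentIdeal = I := by
  classical
  obtain ⟨n, v, hv⟩ := Submodule.fg_iff_exists_fin_generating_family.mp hI
  exact ⟨ofFn n v, (contentIdeal_ofFn v).trans hv⟩

end ContentIdeal

section Roots

variable {S A : Type*} [CommRing S] [CommRing A] {d : ℕ}

/-- The coefficient of `y ^ (d - 1 - j)` in the polynomial `(y - x₁) ⋯ (y - x_d)` with
indeterminate roots, that is, the coefficient `a_{j+1}` as a function of the roots. -/
noncomputable def rootCoeff (S : Type*) [CommRing S] (d : ℕ) (j : Fin d) :
    MvPolynomial (Fin d) S :=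
  (∏ i, (X - C (MvPolynomial.X i)) : (MvPolynomial (Fin d) S)[X]).coeff (d - 1 - j)

theorem coeff_monicPoly (a : Fin d → A) (j : Fin d) :
    (monicPoly a).coeff (d - 1 - j) = a j := by
  rw [monicPoly, coeff_add, coeff_X_pow, if_neg (by omega), zero_add, finsetSum_coeff,
    Finset.sum_eq_single j]
  · simp
  · intro i _ hij
    have := Fin.val_ne_of_ne hij
    rw [coeff_C_mul_X_pow, if_neg (by omega)]
  · simp

theorem map_rootCoeff (f : MvPolynomial (Fin d) S →+* A) (j : Fin d) :
    f (rootCoeff S d j) = (∏ i, (X - C (f (MvPolynomial.X i)))).coeff (d - 1 - j) := by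
  rw [rootCoeff, ← coeff_map, Polynomial.map_prod]
  simp only [Polynomial.map_sub, map_X, map_C]

theorem aeval_rootCoeff [Algebra S A] {a α : Fin d → A} (h : monicPoly a = ∏ i, (X - C (α i)))
    (j : Fin d) : MvPolynomial.aeval α (rootCoeff S d j) = a j := by
  rw [← coeff_monicPoly a j, h, ← AlgHom.coe_toRingHom, map_rootCoeff]
  simp

theorem rename_rootCoeff (e : Equiv.Perm (Fin d)) (j : Fin d) :
    MvPolynomial.rename e (rootCoeff S d j) = rootCoeff S d j := by
  rw [← AlgHom.coe_toRingHom, map_rootCoeff, rootCoeff]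
  simp only [RingHom.coe_coe, MvPolynomial.rename_X]
  rw [Equiv.prod_comp e fun i => (X - C (MvPolynomial.X i) : (MvPolynomial (Fin d) S)[X])]

theorem rootCoeff_eq_esymm (j : Fin d) :
    rootCoeff S d j = (-1) ^ (j + 1 : ℕ) * MvPolynomial.esymm (Fin d) S (j + 1) := by
  have hj : Multiset.card (Finset.univ.val.map fun i : Fin d =>
      (MvPolynomial.X i : MvPolynomial (Fin d) S)) - (d - 1 - j) = j + 1 := by
    simp only [Multiset.card_map, Finset.card_val, Finset.card_univ, Fintype.card_fin]
    omega
  have h := Multiset.prod_X_sub_C_coeff (k := d - 1 - j)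
    (Finset.univ.val.map fun i : Fin d => (MvPolynomial.X i : MvPolynomial (Fin d) S))
    (by simp; omega)
  rw [hj, Multiset.map_map, ← MvPolynomial.esymm_eq_multiset_esymm] at h
  exact h

theorem exists_aeval_rootCoeff_eq {p : MvPolynomial (Fin d) S} (hp : p.IsSymmetric) :
    ∃ g : MvPolynomial (Fin d) S, MvPolynomial.aeval (rootCoeff S d) g = p := by
  obtain ⟨g, hg⟩ := MvPolynomial.esymmAlgHom_surjective (σ := Fin d) S (n := d) (by simp) ⟨p, hp⟩
  have aeval_esymm_g :
      MvPolynomial.aeval (fun i : Fin d => MvPolynomial.esymm (Fin d) S (i + 1)) g = p := by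
    rw [← MvPolynomial.esymmAlgHom_apply, hg]
  refine ⟨MvPolynomial.aeval (fun i : Fin d => (-1) ^ (i + 1 : ℕ) * MvPolynomial.X i) g, ?_⟩
  rw [← aeval_esymm_g, ← AlgHom.comp_apply]
  congr 1
  ext i : 1
  simp [rootCoeff_eq_esymm, ← mul_assoc, ← mul_pow]

theorem exists_map_aeval_rootCoeff_eq {Φ : (MvPolynomial (Fin d) S)[X]}
    (hΦ : ∀ e : Equiv.Perm (Fin d), Φ.map (MvPolynomial.rename e).toRingHom = Φ) :
    ∃ Ψ : (MvPolynomial (Fin d) S)[X],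
      Ψ.map (MvPolynomial.aeval (rootCoeff S d)).toRingHom = Φ := by
  refine (mem_lifts _).mp ((lifts_iff_coeff_lifts Φ).mpr fun n => ?_)
  refine exists_aeval_rootCoeff_eq fun e => ?_
  conv_rhs => rw [← hΦ e, coeff_map]
  rfl

theorem exists_map_aeval_eq_prod {I : Ideal (MvPolynomial (Fin d) S)} (hI : I.FG) :
    ∃ P : Ideal (MvPolynomial (Fin d) S), ∀ (A : Type*) [CommRing A] [IsDomain A]
      [IsPrincipalIdealRing A] [Algebra S A] (a α : Fin d → A),
      monicPoly a = ∏ i, (X - C (α i)) →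
        P.map (MvPolynomial.aeval a) =
          ∏ e : Equiv.Perm (Fin d), I.map (MvPolynomial.aeval (α ∘ e)) := by
  obtain ⟨F, rfl⟩ := exists_contentIdeal_eq hI
  obtain ⟨Ψ, hΨ⟩ := exists_map_aeval_rootCoeff_eq
    (Φ := ∏ e : Equiv.Perm (Fin d), F.map (MvPolynomial.rename e).toRingHom) fun e => by
      rw [Polynomial.map_prod]
      refine Fintype.prod_equiv (Equiv.mulLeft e) _ _ fun e' => ?_
      rw [Polynomial.map_map]
      congr 1
      ext <;> simp
  refine ⟨Ψ.contentIdeal, fun A _ _ _ _ a α h => ?_⟩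
  have map_Ψ : Ψ.map (MvPolynomial.aeval a).toRingHom =
      ∏ e : Equiv.Perm (Fin d), F.map (MvPolynomial.aeval (α ∘ e)).toRingHom := by
    have aeval_a : (MvPolynomial.aeval (R := S) a).toRingHom =
        (MvPolynomial.aeval α).toRingHom.comp (MvPolynomial.aeval (rootCoeff S d)).toRingHom := by
      ext i <;> simp [aeval_rootCoeff h]
    rw [aeval_a, ← Polynomial.map_map, hΨ, Polynomial.map_prod]
    refine Finset.prod_congr rfl fun e _ => ?_
    rw [Polynomial.map_map]
    congr 1
    ext i <;> simp
  calc Ψ.contentIdeal.map (MvPolynomial.aeval a)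
      = (Ψ.map (MvPolynomial.aeval a).toRingHom).contentIdeal :=
        (contentIdeal_map_eq_map_contentIdeal Ψ _).symm
    _ = ∏ e : Equiv.Perm (Fin d), (F.map (MvPolynomial.aeval (α ∘ e)).toRingHom).contentIdeal := by
        rw [map_Ψ, contentIdeal_prod_of_isPrincipalIdealRing]
    _ = ∏ e : Equiv.Perm (Fin d), F.contentIdeal.map (MvPolynomial.aeval (α ∘ e)) :=
        Finset.prod_congr rfl fun e _ => contentIdeal_map_eq_map_contentIdeal F _

theorem map_aeval_comp_perm [Algebra S A] (I : Ideal (MvPolynomial (Fin d) S)) (α : Fin d → A)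
    (e : Equiv.Perm (Fin d)) :
    I.map (MvPolynomial.aeval (α ∘ e)) =
      (I.map (MvPolynomial.rename e)).map (MvPolynomial.aeval α) := by
  rw [Ideal.map_mapₐ]
  congr 1
  ext i
  simp

theorem exists_map_aeval_eq_pow_factorial {I : Ideal (MvPolynomial (Fin d) S)} (hI : I.FG)
    (h_inv : ∀ e : Equiv.Perm (Fin d), I.map (MvPolynomial.rename e) = I) :
    ∃ P : Ideal (MvPolynomial (Fin d) S), ∀ (A : Type*) [CommRing A] [IsDomain A]
      [IsPrincipalIdealRing A] [Algebra S A] (a α : Fin d → A),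
      monicPoly a = ∏ i, (X - C (α i)) →
        P.map (MvPolynomial.aeval a) = I.map (MvPolynomial.aeval α) ^ d.factorial := by
  obtain ⟨P, hP⟩ := exists_map_aeval_eq_prod hI
  refine ⟨P, fun A _ _ _ _ a α h => ?_⟩
  rw [hP A a α h]
  simp only [map_aeval_comp_perm, h_inv, Finset.prod_const, Finset.card_univ, Fintype.card_perm,
    Fintype.card_fin]

end Roots

section Families

variable {R T ι : Type*} [CommSemiring R] [CommSemiring T] [Fintype ι] [DecidableEq ι] {d : ℕ}

/-- The sum of the products of all but one of the ideals `J i`. For ideals of `K⟦t⟧` its order is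
the sum of the orders of the `J i` minus the largest of them. -/
def cofactorIdeal (J : ι → Ideal R) : Ideal R :=
  ⨆ i, ∏ j ∈ Finset.univ.erase i, J j

theorem map_cofactorIdeal {F : Type*} [FunLike F R T] [RingHomClass F R T] (f : F)
    (J : ι → Ideal R) : (cofactorIdeal J).map f = cofactorIdeal fun i => (J i).map f := by
  rw [cofactorIdeal, Ideal.map_iSup]
  exact iSup_congr fun i => map_prod (Ideal.mapHom f) J _

theorem cofactorIdeal_comp_equiv (J : ι → Ideal R) (e : Equiv.Perm ι) :
    cofactorIdeal (J ∘ e) = cofactorIdeal J := by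
  refine Equiv.iSup_congr e fun i => (Finset.prod_equiv e (fun j => ?_) fun _ _ => rfl).symm
  simp

theorem prod_prod_erase (J : ι → Ideal R) :
    ∏ i, ∏ j ∈ Finset.univ.erase i, J j = (∏ j, J j) ^ (Fintype.card ι - 1) := by
  have erase_swap (i j : ι) : i ∈ Finset.univ ∧ j ∈ Finset.univ.erase i ↔
      i ∈ Finset.univ.erase j ∧ j ∈ Finset.univ := by
    simp [eq_comm]
  rw [Finset.prod_comm' erase_swap, ← Finset.prod_pow]
  simp

theorem prod_pow_le_cofactorIdeal_pow (J : ι → Ideal R) :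
    (∏ i, J i) ^ (Fintype.card ι - 1) ≤ cofactorIdeal J ^ Fintype.card ι := by
  rw [← prod_prod_erase, ← Finset.card_univ, ← Finset.prod_const]
  exact Finset.prod_le_prod' fun i _ => le_iSup (fun i => ∏ j ∈ Finset.univ.erase i, J j) i

/-- A family of ideals indexed by the variables that is permuted along with them: `J i` depends
symmetrically on the variables other than the `i`-th one. -/
def IsPermEquivariant (J : Fin d → Ideal (MvPolynomial (Fin d) R)) : Prop :=
  ∀ (e : Equiv.Perm (Fin d)) (i : Fin d), (J i).map (MvPolynomial.rename e) = J (e i)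

namespace IsPermEquivariant

variable {J J' : Fin d → Ideal (MvPolynomial (Fin d) R)}

theorem map_prod (hJ : IsPermEquivariant J) (e : Equiv.Perm (Fin d)) :
    (∏ i, J i).map (MvPolynomial.rename e) = ∏ i, J i := by
  rw [← Ideal.mapHom_apply, _root_.map_prod]
  exact (Finset.prod_congr rfl fun i _ => hJ e i).trans (Equiv.prod_comp e J)

theorem map_cofactorIdeal (hJ : IsPermEquivariant J) (e : Equiv.Perm (Fin d)) :
    (cofactorIdeal J).map (MvPolynomial.rename e) = cofactorIdeal J := by
  rw [_root_.map_cofactorIdeal, ← cofactorIdeal_comp_equiv J e]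
  exact congrArg cofactorIdeal (funext fun i => hJ e i)

theorem pow_mul_pow (hJ : IsPermEquivariant J) (hJ' : IsPermEquivariant J') (m n : ℕ) :
    IsPermEquivariant fun i => J i ^ m * J' i ^ n := fun e i => by
  rw [Ideal.map_mul, Ideal.map_pow, Ideal.map_pow, hJ e i, hJ' e i]

end IsPermEquivariant

end Families

section QIdealOrder

variable {R : Type*} [CommRing R]

theorem QSymbol.LE.of_pow_le {s t : QSymbol R} {n : ℕ} (h : s.ideal ^ n ≤ t.ideal)
    (hn : n * t.exp = s.exp) : s.LE t := by
  intro m n₁ n₂ _ h₁ h₂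
  have hn₁ : n₁ = n * n₂ := by
    have : (n₁ : ℚ≥0) = n * n₂ := by rw [← h₁, ← h₂, ← hn, mul_left_comm]
    exact_mod_cast this
  rw [hn₁, pow_mul]
  exact (Ideal.pow_right_mono h n₂).trans (le_idealClosure _)

/-- The `ℚ`-ideal given by the symbol `I ^ q`. -/
def QIdeal.mk (I : Ideal R) (q : ℚ≥0) (hq : 0 < q) : QIdeal R :=
  Quotient.mk _ ⟨I, q, hq⟩

theorem QIdeal.mk_pow (I : Ideal R) {n : ℕ} {q r : ℚ≥0} (hq : 0 < q) (hr : 0 < r)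
    (hqr : n * r = q) : QIdeal.mk (I ^ n) r hr = QIdeal.mk I q hq := by
  subst hqr
  refine Quotient.sound fun m n₁ n₂ _ h₁ h₂ => ?_
  have hn₂ : n₂ = n * n₁ := by
    have : (n₂ : ℚ≥0) = n * n₁ := by rw [← h₁, ← h₂, mul_left_comm]
    exact_mod_cast this
  rw [hn₂, pow_mul]

variable {K ι : Type*} [Field K]

theorem QSymbol.ord_prod (N : ℕ) (s : Finset ι) (J : ι → Ideal (PowerSeries K)) (q : ℚ≥0)
    (hq : 0 < q) :
    QSymbol.ord N ⟨∏ i ∈ s, J i, q, hq⟩ = ∑ i ∈ s, QSymbol.ord N ⟨J i, q, hq⟩ := by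
  simp only [QSymbol.ord, idealOrd_prod, div_eq_mul_inv, ← Finset.mul_sum, ← Finset.sum_mul]
  rw [← ENat.toENNRealRingHom_apply, map_sum]

theorem QSymbol.ord_iSup {N : ℕ} (hN : N ≠ 0) (J : ι → Ideal (PowerSeries K)) (q : ℚ≥0)
    (hq : 0 < q) : QSymbol.ord N ⟨⨆ i, J i, q, hq⟩ = ⨅ i, QSymbol.ord N ⟨J i, q, hq⟩ := by
  have hq0 : ((q : ℝ≥0) : ℝ≥0∞) ≠ 0 := by exact_mod_cast hq.ne'
  simp only [QSymbol.ord, idealOrd_iSup, ENat.toENNReal_iInf]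
  rw [ENNReal.iInf_div_of_ne (Nat.cast_ne_zero.mpr hN) (ENNReal.natCast_ne_top N),
    ENNReal.mul_iInf_of_ne hq0 ENNReal.coe_ne_top]

theorem ordSub_add_cancel_right {x y : ℝ≥0∞} (h : x + y = ⊤ → x = ⊤) : ordSub (x + y) y = x := by
  unfold ordSub
  split_ifs with h_top
  · rw [h h_top, EReal.coe_ennreal_top]
  · obtain ⟨hx, hy⟩ := ENNReal.add_ne_top.mp h_top
    lift x to ℝ≥0 using hx
    lift y to ℝ≥0 using hy
    rw [EReal.coe_ennreal_add, EReal.coe_nnreal_eq_coe_real y, EReal.add_sub_cancel_right]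

theorem sum_erase_le_sum_erase {M : Type*} [AddCommMonoid M] [Preorder M] [IsOrderedAddMonoid M]
    [DecidableEq ι] {s : Finset ι} {b : ι → M} {i j : ι} (hi : i ∈ s) (hj : j ∈ s)
    (h : b i ≤ b j) : ∑ l ∈ s.erase j, b l ≤ ∑ l ∈ s.erase i, b l := by
  rcases eq_or_ne i j with rfl | hij
  · exact le_rfl
  calc ∑ l ∈ s.erase j, b l
      = b i + ∑ l ∈ (s.erase j).erase i, b l :=
        (Finset.add_sum_erase _ b (Finset.mem_erase.mpr ⟨hij, hi⟩)).symm
    _ ≤ b j + ∑ l ∈ (s.erase i).erase j, b l := by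
        rw [Finset.erase_right_comm]
        gcongr
    _ = ∑ l ∈ s.erase i, b l :=
        Finset.add_sum_erase _ b (Finset.mem_erase.mpr ⟨hij.symm, hj⟩)

theorem ordSub_sum_iInf_sum_erase [Fintype ι] [DecidableEq ι] [Nonempty ι] (b : ι → ℝ≥0∞) :
    ordSub (∑ i, b i) (⨅ i, ∑ j ∈ Finset.univ.erase i, b j) = (⨆ i, b i : ℝ≥0∞) := by
  obtain ⟨i₀, hi₀⟩ := exists_eq_ciSup_of_finite (f := b)
  have le_max (i : ι) : b i ≤ b i₀ := hi₀ ▸ le_iSup b i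
  have iInf_eq : ⨅ i, ∑ j ∈ Finset.univ.erase i, b j = ∑ j ∈ Finset.univ.erase i₀, b j :=
    (iInf_le _ i₀).antisymm (le_iInf fun i =>
      sum_erase_le_sum_erase (Finset.mem_univ i) (Finset.mem_univ i₀) (le_max i))
  rw [iInf_eq, ← hi₀, ← Finset.add_sum_erase _ b (Finset.mem_univ i₀)]
  refine ordSub_add_cancel_right fun h_top => ?_
  rw [Finset.add_sum_erase _ b (Finset.mem_univ i₀), ENNReal.sum_eq_top] at h_top
  obtain ⟨i, -, hi⟩ := h_top
  exact top_le_iff.mp (hi ▸ le_max i)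

theorem iSup_ord_eq_ordSub [Fintype ι] [DecidableEq ι] [Nonempty ι] {N : ℕ} (hN : N ≠ 0)
    (J : ι → Ideal (PowerSeries K)) (q : ℚ≥0) (hq : 0 < q) :
    ((⨆ i, QSymbol.ord N ⟨J i, q, hq⟩ : ℝ≥0∞) : EReal) =
      ordSub (QSymbol.ord N ⟨∏ i, J i, q, hq⟩) (QSymbol.ord N ⟨cofactorIdeal J, q, hq⟩) := by
  simp only [cofactorIdeal, QSymbol.ord_iSup hN, QSymbol.ord_prod]
  exact (ordSub_sum_iInf_sum_erase _).symm

theorem QIdeal.ord_evalAt_expand [CharZero K] {n N : ℕ} (hN : N ≠ 0)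
    (𝔟 : QIdeal (MvPolynomial (Fin n) ℚ)) (a : Fin n → PowerSeries K) :
    (𝔟.evalAt fun j => PowerSeries.expand N hN (a j)).ord N = (𝔟.evalAt a).ord 1 := by
  have hN' : (N : ℝ≥0∞) ≠ 0 := Nat.cast_ne_zero.mpr hN
  have aeval_expand : MvPolynomial.aeval (R := ℚ) (fun j => PowerSeries.expand N hN (a j)) =
      ((PowerSeries.expand N hN).restrictScalars ℚ).comp (MvPolynomial.aeval a) := by
    ext j
    simp
  induction 𝔟 using Quotient.inductionOn with | h s
  change (s.exp : ℝ≥0∞) * (idealOrd (s.ideal.map (MvPolynomial.aeval _)) / N) =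
    s.exp * (idealOrd (s.ideal.map (MvPolynomial.aeval a)) / (1 : ℕ))
  rw [aeval_expand, ← Ideal.map_mapₐ]
  change _ * ((idealOrd (Ideal.map (PowerSeries.expand N hN) _) : ℝ≥0∞) / N) = _
  rw [idealOrd_map_expand, ENat.toENNReal_mul, ENat.toENNReal_coe, mul_comm (N : ℝ≥0∞),
    ENNReal.mul_div_cancel_right hN' (ENNReal.natCast_ne_top N), Nat.cast_one, div_one]

end QIdealOrder

section Maximum

variable {d : ℕ}

theorem QIdeal.map_le_map_pow {R T : Type*} [CommRing R] [CommRing T] (φ : R →+* T)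
    {𝔞 𝔟 : QIdeal R} {r : ℚ≥0} (hr : 0 < r) (h : 𝔞 ≤ 𝔟.pow r hr) :
    𝔞.map φ ≤ (𝔟.map φ).pow r hr := by
  induction 𝔞, 𝔟 using Quotient.inductionOn₂ with | h s t
  exact QSymbol.LE.map φ (t := t.pow r hr) h

theorem QIdeal.evalAt_mk_eq {K : Type*} [Field K] [CharZero K] {P : Ideal (MvPolynomial (Fin d) ℚ)}
    {u : Fin d → PowerSeries K} {I : Ideal (PowerSeries K)} {n : ℕ} {q r : ℚ≥0}
    (hP : P.map (MvPolynomial.aeval u) = I ^ n) (hq : 0 < q) (hr : 0 < r) (hqr : n * r = q) :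
    (QIdeal.mk P r hr).evalAt u = QIdeal.mk I q hq := by
  rw [← QIdeal.mk_pow I hq hr hqr, ← hP]
  rfl

theorem IsPermEquivariant.exists_iSup_ord_eq [NeZero d]
    {J : Fin d → Ideal (MvPolynomial (Fin d) ℚ)} (hJ : IsPermEquivariant J) (q : ℚ≥0)
    (hq : 0 < q) :
    ∃ 𝔟plus 𝔟minus : QIdeal (MvPolynomial (Fin d) ℚ), ∀ (K : Type*) [Field K] [CharZero K],
      (∀ hd : 2 ≤ d, 𝔟plus.baseChange K ≤
        (𝔟minus.baseChange K).pow ((d : ℚ≥0) / ((d - 1 : ℕ) : ℚ≥0)) (exponent_pos hd)) ∧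
      ∀ (N : ℕ) (hN : N ≠ 0) (a α : Fin d → PowerSeries K), AreRoots N hN a α →
        ((⨆ i, QSymbol.ord N ⟨(J i).map (MvPolynomial.aeval α), q, hq⟩ : ℝ≥0∞) : EReal) =
          ordSub ((𝔟plus.evalAt a).ord 1) ((𝔟minus.evalAt a).ord 1) := by
  obtain ⟨P, hP⟩ := exists_map_aeval_eq_pow_factorial
    (Ideal.fg_of_isNoetherianRing (∏ i, J i)) hJ.map_prod
  obtain ⟨B, hB⟩ := exists_map_aeval_eq_pow_factorial
    (Ideal.fg_of_isNoetherianRing (cofactorIdeal J)) hJ.map_cofactorIdeal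
  have hfac : (d.factorial : ℚ≥0) ≠ 0 := Nat.cast_ne_zero.mpr d.factorial_ne_zero
  have hdfac : 0 < d * d.factorial := Nat.mul_pos (NeZero.pos d) d.factorial_pos
  -- At the roots `P ^ (d - 1)` is absorbed by `B ^ d`; adding it makes the two `ℚ`-ideals
  -- comparable already in the polynomial ring.
  refine ⟨QIdeal.mk P (q / d.factorial) (by positivity),
    QIdeal.mk (B ^ d ⊔ P ^ (d - 1)) (q / (d * d.factorial : ℕ))
      (div_pos hq (Nat.cast_pos.mpr hdfac)),
    fun K _ _ => ⟨fun hd => ?_, fun N hN a α hα => ?_⟩⟩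
  · refine QIdeal.map_le_map_pow _ _ (QSymbol.LE.of_pow_le (n := d - 1) le_sup_right ?_)
    have hd1 : ((d - 1 : ℕ) : ℚ≥0) ≠ 0 := Nat.cast_ne_zero.mpr (by omega)
    simp only [QSymbol.pow, Nat.cast_mul]
    field_simp
  · set u : Fin d → PowerSeries K := fun j => PowerSeries.expand N hN (a j)
    set J' : Fin d → Ideal (PowerSeries K) := fun i => (J i).map (MvPolynomial.aeval α)
    have map_P : P.map (MvPolynomial.aeval u) = (∏ i, J' i) ^ d.factorial :=
      (hP _ u α hα).trans
        (congrArg (· ^ _) (_root_.map_prod (Ideal.mapHom (MvPolynomial.aeval α)) J _))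
    have map_minus : (B ^ d ⊔ P ^ (d - 1)).map (MvPolynomial.aeval u) =
        cofactorIdeal J' ^ (d * d.factorial) := by
      have prod_le := Ideal.pow_right_mono (prod_pow_le_cofactorIdeal_pow J') d.factorial
      rw [Fintype.card_fin, ← pow_mul, ← pow_mul, mul_comm (d - 1)] at prod_le
      rw [Ideal.map_sup, Ideal.map_pow, Ideal.map_pow, hB _ u α hα, map_P, _root_.map_cofactorIdeal,
        ← pow_mul, ← pow_mul, mul_comm d.factorial d]
      exact sup_eq_left.mpr prod_le
    rw [← QIdeal.ord_evalAt_expand hN, ← QIdeal.ord_evalAt_expand hN,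
      QIdeal.evalAt_mk_eq map_P hq _ (mul_div_cancel₀ _ hfac),
      QIdeal.evalAt_mk_eq map_minus hq _ (mul_div_cancel₀ _ (Nat.cast_ne_zero.mpr hdfac.ne'))]
    exact iSup_ord_eq_ordSub hN J' q hq

end Maximum

section RootSubstitution

variable {S : Type*} [CommRing S] {d : ℕ}

/-- The substitution of the coefficients of `(y - x₁) ⋯ (y - x_d)` for `z₁, …, z_d` and of the
root `xᵢ` for `z_{d+1}`. -/
noncomputable def substRoot (S : Type*) [CommRing S] (i : Fin d) :
    MvPolynomial (Fin (d + 1)) S →ₐ[S] MvPolynomial (Fin d) S :=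
  MvPolynomial.aeval (Fin.snoc (rootCoeff S d) (MvPolynomial.X i))

theorem algHom_comp_substRoot {A : Type*} [CommRing A] [Algebra S A]
    (f : MvPolynomial (Fin d) S →ₐ[S] A) (i : Fin d) :
    f.comp (substRoot S i) = MvPolynomial.aeval
      (Fin.snoc (fun j => f (rootCoeff S d j)) (f (MvPolynomial.X i)) : Fin (d + 1) → A) := by
  ext j
  induction j using Fin.lastCases <;> simp [substRoot]

theorem isPermEquivariant_map_substRoot (J : Ideal (MvPolynomial (Fin (d + 1)) S)) :
    IsPermEquivariant fun i => J.map (substRoot S i) := fun e i => by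
  rw [Ideal.map_mapₐ, algHom_comp_substRoot]
  simp only [rename_rootCoeff, MvPolynomial.rename_X, substRoot]

theorem map_substRoot_map_aeval {A : Type*} [CommRing A] [Algebra S A] {a α : Fin d → A}
    (h : monicPoly a = ∏ i, (X - C (α i))) (J : Ideal (MvPolynomial (Fin (d + 1)) S)) (i : Fin d) :
    (J.map (substRoot S i)).map (MvPolynomial.aeval α) =
      J.map (MvPolynomial.aeval (Fin.snoc a (α i) : Fin (d + 1) → A)) := by
  rw [Ideal.map_mapₐ, algHom_comp_substRoot]
  simp only [aeval_rootCoeff h, MvPolynomial.aeval_X]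

end RootSubstitution

section Differences

variable {S K : Type*} [CommRing S] [Field K] {d : ℕ}

/-- The ideal generated by the products of `k` of the differences `xⱼ - xᵢ`, over distinct `j`. -/
noncomputable def differenceIdeal (S : Type*) [CommRing S] (k : ℕ) (i : Fin d) :
    Ideal (MvPolynomial (Fin d) S) :=
  Ideal.span (Set.range fun j : Fin k ↪ Fin d =>
    ∏ l, (MvPolynomial.X (j l) - MvPolynomial.X i))

theorem isPermEquivariant_differenceIdeal (k : ℕ) :
    IsPermEquivariant (differenceIdeal S k : Fin d → _) := fun e i => by
  rw [differenceIdeal, Ideal.map_span, ← Set.range_comp]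
  refine congrArg Ideal.span (Eq.trans (congrArg Set.range (funext fun j => ?_))
    ((Equiv.embeddingCongr (Equiv.refl (Fin k)) e).surjective.range_comp _))
  simp [map_prod]

theorem minOrdProd_eq_idealOrd [Algebra S (PowerSeries K)] {N : ℕ} (hN : N ≠ 0) (k : ℕ)
    (α : Fin d → PowerSeries K) (i : Fin d) :
    minOrdProd N k α (α i) =
      (idealOrd ((differenceIdeal S k i).map (MvPolynomial.aeval α)) : ℝ≥0∞) / N := by
  rw [differenceIdeal, Ideal.map_span, ← Set.range_comp, idealOrd_span, iInf_range,
    ENat.toENNReal_iInf,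
    ENNReal.iInf_div_of_ne (Nat.cast_ne_zero.mpr hN) (ENNReal.natCast_ne_top N)]
  simp [minOrdProd, ordT, map_prod]

theorem QSymbol.ord_pow_mul_pow (N : ℕ) (I I' : Ideal (PowerSeries K)) (c c' : ℚ≥0)
    (h : 0 < ((c.den : ℚ≥0) * c'.den)⁻¹) :
    QSymbol.ord N ⟨I ^ (c.num * c'.den) * I' ^ (c'.num * c.den), ((c.den : ℚ≥0) * c'.den)⁻¹, h⟩ =
      ((c : ℝ≥0) : ℝ≥0∞) * ((idealOrd I : ℝ≥0∞) / N) +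
        ((c' : ℝ≥0) : ℝ≥0∞) * ((idealOrd I' : ℝ≥0∞) / N) := by
  have inv_mul (x y : ℚ≥0) :
      ((((x.den : ℚ≥0) * y.den)⁻¹ : ℚ≥0) : ℝ≥0) * (x.num * y.den : ℕ) = x := by
    have hx : (x.den : ℚ≥0) ≠ 0 := Nat.cast_ne_zero.mpr x.den_ne_zero
    have hy : (y.den : ℚ≥0) ≠ 0 := Nat.cast_ne_zero.mpr y.den_ne_zero
    have : ((x.den : ℚ≥0) * y.den)⁻¹ * (x.num * y.den : ℕ) = x := by
      conv_rhs => rw [← NNRat.num_div_den x]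
      push_cast
      field_simp
    exact_mod_cast congrArg (NNRat.cast (K := ℝ≥0)) this
  have cast_inv_mul (x y : ℚ≥0) : (((((x.den : ℚ≥0) * y.den)⁻¹ : ℚ≥0) : ℝ≥0) : ℝ≥0∞) *
      (x.num * y.den : ℕ) = ((x : ℝ≥0) : ℝ≥0∞) := by
    rw [← ENNReal.coe_natCast, ← ENNReal.coe_mul, inv_mul]
  rw [← cast_inv_mul c c', ← cast_inv_mul c' c, mul_comm (c'.den : ℚ≥0)]
  simp only [QSymbol.ord, idealOrd_mul, idealOrd_pow, ENat.toENNReal_add, ENat.toENNReal_mul,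
    ENat.toENNReal_coe, div_eq_mul_inv]
  ring

end Differences

theorem corollary4p10_general :
    (∀ (d k : ℕ), 1 ≤ k → k ≤ d → ∀ c₁ c₂ : ℚ≥0,
      ∃ 𝔭plus 𝔭minus : QIdeal (MvPolynomial (Fin d) ℚ),
        ∀ (K : Type*) [Field K] [CharZero K],
          (∀ hd : 2 ≤ d, 𝔭plus.baseChange K ≤
            (𝔭minus.baseChange K).pow ((d : ℚ≥0) / ((d - 1 : ℕ) : ℚ≥0)) (exponent_pos hd)) ∧
          ∀ (N : ℕ) (hN : N ≠ 0) (a α : Fin d → PowerSeries K), AreRoots N hN a α →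
            (((⨆ i : Fin d, (((c₁ : ℝ≥0) : ℝ≥0∞) * minOrdProd N (k - 1) α (α i) +
                ((c₂ : ℝ≥0) : ℝ≥0∞) * minOrdProd N k α (α i)) : ℝ≥0∞)) : EReal) =
              ordSub ((𝔭plus.evalAt a).ord 1) ((𝔭minus.evalAt a).ord 1)) ∧
    (∀ (d : ℕ), 1 ≤ d → ∀ 𝔟 : QIdeal (MvPolynomial (Fin (d + 1)) ℚ),
      ∃ 𝔟plus 𝔟minus : QIdeal (MvPolynomial (Fin d) ℚ),
        ∀ (K : Type*) [Field K] [CharZero K],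
          (∀ hd : 2 ≤ d, 𝔟plus.baseChange K ≤
            (𝔟minus.baseChange K).pow ((d : ℚ≥0) / ((d - 1 : ℕ) : ℚ≥0)) (exponent_pos hd)) ∧
          ∀ (N : ℕ) (hN : N ≠ 0) (a α : Fin d → PowerSeries K), AreRoots N hN a α →
            (((⨆ i : Fin d, (𝔟.evalAt
                (Fin.snoc (fun j => PowerSeries.expand N hN (a j)) (α i))).ord N : ℝ≥0∞)) : EReal) =
              ordSub ((𝔟plus.evalAt a).ord 1) ((𝔟minus.evalAt a).ord 1)) := by
  refine ⟨fun d k hk hkd c₁ c₂ => ?_, fun d hd 𝔟 => ?_⟩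
  · have : NeZero d := ⟨by omega⟩
    have hq : 0 < ((c₁.den : ℚ≥0) * c₂.den)⁻¹ := by positivity
    obtain ⟨p, m, h⟩ := ((isPermEquivariant_differenceIdeal (d := d) (k - 1)).pow_mul_pow
      (isPermEquivariant_differenceIdeal k) (c₁.num * c₂.den) (c₂.num * c₁.den)).exists_iSup_ord_eq
        _ hq
    refine ⟨p, m, fun K _ _ => ⟨(h K).1, fun N hN a α hα => Eq.trans ?_ ((h K).2 N hN a α hα)⟩⟩
    simp only [Ideal.map_mul, Ideal.map_pow, QSymbol.ord_pow_mul_pow,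
      minOrdProd_eq_idealOrd (S := ℚ) hN]
  · have : NeZero d := ⟨by omega⟩
    induction 𝔟 using Quotient.inductionOn with | h s
    obtain ⟨p, m, h⟩ :=
      (isPermEquivariant_map_substRoot s.ideal).exists_iSup_ord_eq s.exp s.exp_pos
    refine ⟨p, m, fun K _ _ => ⟨(h K).1, fun N hN a α hα => Eq.trans ?_ ((h K).2 N hN a α hα)⟩⟩
    simp only [map_substRoot_map_aeval hα]
    rfl

theorem corollary4p10 :
    -- existence of `𝔭plus`, `𝔭minus` for given `d`, `k`, `c₁`, `c₂`
    (∀ (d k : ℕ), 1 ≤ k → k ≤ d → ∀ c₁ c₂ : ℚ≥0,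
      ∃ 𝔭plus 𝔭minus : QIdeal (MvPolynomial (Fin d) ℚ),
        ∀ (K : Type*) [Field K] [IsAlgClosed K] [CharZero K],
          (∀ hd : 2 ≤ d, 𝔭plus.baseChange K ≤
            (𝔭minus.baseChange K).pow ((d : ℚ≥0) / ((d - 1 : ℕ) : ℚ≥0)) (exponent_pos hd)) ∧
          ∀ (N : ℕ) (hN : N ≠ 0) (a α : Fin d → PowerSeries K), AreRoots N hN a α →
            (((⨆ i : Fin d, (((c₁ : ℝ≥0) : ℝ≥0∞) * minOrdProd N (k - 1) α (α i) +
                ((c₂ : ℝ≥0) : ℝ≥0∞) * minOrdProd N k α (α i)) : ℝ≥0∞)) : EReal) =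
              ordSub ((𝔭plus.evalAt a).ord 1) ((𝔭minus.evalAt a).ord 1)) ∧
    -- the general case: the maximum over the roots of `ord 𝔟(a, αᵢ)`
    (∀ (d : ℕ), 1 ≤ d → ∀ 𝔟 : QIdeal (MvPolynomial (Fin (d + 1)) ℚ),
      ∃ 𝔟plus 𝔟minus : QIdeal (MvPolynomial (Fin d) ℚ),
        ∀ (K : Type*) [Field K] [IsAlgClosed K] [CharZero K],
          (∀ hd : 2 ≤ d, 𝔟plus.baseChange K ≤
            (𝔟minus.baseChange K).pow ((d : ℚ≥0) / ((d - 1 : ℕ) : ℚ≥0)) (exponent_pos hd)) ∧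
          ∀ (N : ℕ) (hN : N ≠ 0) (a α : Fin d → PowerSeries K), AreRoots N hN a α →
            (((⨆ i : Fin d, (𝔟.evalAt
                (Fin.snoc (fun j => PowerSeries.expand N hN (a j)) (α i))).ord N : ℝ≥0∞)) : EReal) =
              ordSub ((𝔟plus.evalAt a).ord 1) ((𝔟minus.evalAt a).ord 1)) :=
  corollary4p10_general.imp
    (fun h d k hk hkd c₁ c₂ => (h d k hk hkd c₁ c₂).imp fun _ ⟨m, h⟩ => ⟨m, fun K _ _ _ => h K⟩)
    fun h d hd 𝔟 => (h d hd 𝔟).imp fun _ ⟨m, h⟩ => ⟨m, fun K _ _ _ => h K⟩
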